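/- Setting. Let $\Omega\subset\mathbb R^2$ be a bounded polygonal open set with $\Omega=\operatorname{int}\overline\Omega$, decomposed into a finite conforming mesh $\Omega_h$ of cells $P$ enclosed by simple polygons. For a scalar function $v$ put $\mathbf{rot}\,v=(\partial_y v,-\partial_x v)$, for a vector field $\mathrm{rot}\,w=\partial_x w_y-\partial_y w_x$, and $a\times b=a_xb_y-a_yb_x$; all derivatives are weak. Spaces. $\mathcal V_h$ is the space of all $v\in H(\mathbf{rot};\Omega)$ such that on each cell $P$ the trace of $v$ on $\partial P$ is continuous and affine on each edge, and $\mathrm{rot}\,\mathbf{rot}\,v=-\Delta v=0$ in $P$; $\mathcal V_{h,0}$ is the subspace of functions with zero trace on $\partial\Omega$. $\mathcal E_h$ is the space of all $w\in H(\mathrm{div};\Omega)$ such that on each cell $P$ the normal component of $w$ is constant on each edge, $\mathrm{div}\,w$ is constant, and $\mathrm{rot}\,w=0$ in $P$. Operators. $\mathcal I^{\mathcal V_h}f\in\mathcal V_h$ has the same values as $f$ at all mesh vertices; for a function that is only cellwise continuous, the value at a vertex is a fixed weighted mean (nonnegative weights with sum $1$) of the values from the cells that share the vertex. $\mathcal I^{\mathcal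 E_h}F\in\mathcal E_h$ has the same mean normal component as $F$ on every edge; it is considered for $F\in H(\mathrm{div};\Omega)$ whose normal trace on each edge is an integrable function. $\Pi^{RT}$ is, cell by cell, the $L^2(P)$-orthogonal projection onto $RT_0(P)=\{a+bx: a\in\mathbb R^2, b\in\mathbb R\}$. Inner products. On $\mathcal E_h$, $$(v,w)_{\mathcal E_h}=\sum_P\Big(\int_P\Pi^{RT}v\cdot\Pi^{RT}w+S_P\big((I-\Pi^{RT})v,(I-\Pi^{RT})w\big)\Big),$$ where each $S_P$ is a symmetric bilinear form such that $s_*\|z\|_{L^2(P)}^2\le S_P(z,z)\le s^*\|z\|_{L^2(P)}^2$ for all $z=(I-\Pi^{RT})w$, $w\in\mathcal E_h(P)$, with constants $s_*>0$ and $s^*$. On $\mathcal V_h$, $$(v,w)_{\mathcal V_h}=\sum_P\Big(\int_P\Pi_Pv\,\Pi_Pw+S'_P(v-\Pi_Pv,w-\Pi_Pw)\Big),$$ where $\Pi_P:\mathcal V_h(P)\to L^2(P)$ is linear and exact on affine functions, $S'_P$ is a symmetric positive semidefinite bilinear form, and the cell contribution to $(v,v)_{\mathcal V_h}$ lies between $\alpha_*\|v\|_{L^2(P)}^2$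 and $\alpha^*\|v\|_{L^2(P)}^2$ for all $v\in\mathcal V_h(P)$, with constants $\alpha_*>0$ and $\alpha^*$. Here $\mathcal E_h(P)$ and $\mathcal V_h(P)$ are the corresponding local spaces. Scheme. Let $\theta\in[0,1]$, $\Delta t>0$, $N\ge 0$, let a velocity $u$ and an electric field $E_0$ be given, and write $E_0^{n+\theta}=E_0(\cdot,(n+\theta)\Delta t)$. The fields $B_h^n\in\mathcal E_h$ $(0\le n\le N)$ and $\widehat E_h^{n+\theta}\in\mathcal V_{h,0}$ $(0\le n<N)$ solve the virtual element scheme if, with $E_h^{n+\theta}=\widehat E_h^{n+\theta}+\mathcal I^{\mathcal V_h}E_0^{n+\theta}$ and $B_h^{n+\theta}=\theta B_h^{n+1}+(1-\theta)B_h^n$, for all $0\le n<N$, $$\Big(\frac{B_h^{n+1}-B_h^n}{\Delta t},w_h\Big)_{\mathcal E_h}+\big(\mathbf{rot}\,E_h^{n+\theta},w_h\big)_{\mathcal E_h}=0\qquad\text{for all }w_h\in\mathcal E_h,$$ $$\big(E_h^{n+\theta},v_h\big)_{\mathcal V_h}+\big(\mathcal I^{\mathcal V_h}(u\times\Pi^{RT}B_h^{n+\theta}),v_h\big)_{\mathcal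 V_h}-\big(B_h^{n+\theta},\mathbf{rot}\,v_h\big)_{\mathcal E_h}=0\qquad\text{for all }v_h\in\mathcal V_{h,0},$$ and $B_h^0=\mathcal I^{\mathcal E_h}B_0$. Theorem. Let $B_0\in L^2(\Omega)^2$ with $\mathrm{div}\,B_0=0$ in $\Omega$, and let $\{B_h^n\}_{n=0}^N\subset\mathcal E_h$ and $\{\widehat E_h^{n+\theta}\}\subset\mathcal V_{h,0}$ be a solution of the virtual element scheme with $B_h^0=\mathcal I^{\mathcal E_h}B_0$. Then $\mathrm{div}\,B_h^n=0$ in $\Omega$ for every $0\le n\le N$. -/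

import Mathlib

open MeasureTheory Set Filter Topology
open scoped ContDiff

noncomputable section

namespace VEM

/-- The plane with its Euclidean structure. -/
abbrev E2 : Type := EuclideanSpace ℝ (Fin 2)

/-! ### Differential operators on smooth functions -/

/-- The partial derivative of `f` in the coordinate direction `i`. -/
def pderiv (i : Fin 2) (f : E2 → ℝ) (x : E2) : ℝ :=
  fderiv ℝ f x (EuclideanSpace.single i 1)

/-- The gradient of a scalar function. -/
def grad (f : E2 → ℝ) (x : E2) : E2 := !₂[pderiv 0 f x, pderiv 1 f x]

/-- The vector-valued rotor `(∂f/∂y, -∂f/∂x)` of a scalar function. -/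
def rotScalar (f : E2 → ℝ) (x : E2) : E2 := !₂[pderiv 1 f x, -pderiv 0 f x]

/-- The scalar rotor `∂ψ_y/∂x - ∂ψ_x/∂y` of a vector field. -/
def rotVector (ψ : E2 → E2) (x : E2) : ℝ :=
  pderiv 0 (fun y => ψ y 1) x - pderiv 1 (fun y => ψ y 0) x

/-- The planar cross product. -/
def cross (a b : E2) : ℝ := a 0 * b 1 - a 1 * b 0

/-! ### Weak derivatives on an open set -/

/-- `φ` is a smooth function with compact support contained in `U`. -/
def IsTest {F : Type*} [NormedAddCommGroup F] [NormedSpace ℝ F] (U : Set E2) (φ : E2 → F) : Prop :=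
  ContDiff ℝ ∞ φ ∧ HasCompactSupport φ ∧ tsupport φ ⊆ U

/-- `v` is square integrable on `U`. -/
def IsL2 {F : Type*} [NormedAddCommGroup F] (U : Set E2) (v : E2 → F) : Prop :=
  MemLp v 2 (volume.restrict U)

/-- `div v = d` in `U`, in the sense of distributions. -/
def HasWeakDiv (U : Set E2) (v : E2 → E2) (d : E2 → ℝ) : Prop :=
  ∀ φ : E2 → ℝ, IsTest U φ → ∫ x in U, inner ℝ (v x) (grad φ x) = -∫ x in U, d x * φ x

/-- The scalar rotor of the vector field `v` vanishes in `U`, in the sense of distributions. -/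
def HasWeakRotZero (U : Set E2) (v : E2 → E2) : Prop :=
  ∀ φ : E2 → ℝ, IsTest U φ → ∫ x in U, inner ℝ (v x) (rotScalar φ x) = 0

/-- The vector rotor of the scalar function `v` is `r` in `U`, in the sense of distributions. -/
def HasWeakRot (U : Set E2) (v : E2 → ℝ) (r : E2 → E2) : Prop :=
  ∀ ψ : E2 → E2, IsTest U ψ → ∫ x in U, inner ℝ (r x) (ψ x) = ∫ x in U, v x * rotVector ψ x

/-- The space `H(div; U)`. -/
def IsHDiv (U : Set E2) (v : E2 → E2) : Prop :=
  IsL2 U v ∧ ∃ d : E2 → ℝ, IsL2 U d ∧ HasWeakDiv U v d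

/-- The space `H(rot; U)` of scalar functions, which in the plane is `H¹(U)`. -/
def IsHRot (U : Set E2) (v : E2 → ℝ) : Prop :=
  IsL2 U v ∧ ∃ r : E2 → E2, IsL2 U r ∧ HasWeakRot U v r

open Classical in
/-- The weak rotor of `v ∈ H(rot; U)` (unique almost everywhere in `U`). -/
def weakRot (U : Set E2) (v : E2 → ℝ) : E2 → E2 :=
  if h : ∃ r : E2 → E2, IsL2 U r ∧ HasWeakRot U v r then h.choose else 0

/-- Zero trace on the boundary of `U`: Green's formula holds without a boundary term, for test
fields that need not vanish near the boundary. -/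
def HasZeroTrace (U : Set E2) (v : E2 → ℝ) : Prop :=
  ∀ ψ : E2 → E2, ContDiff ℝ ∞ ψ → HasCompactSupport ψ →
    ∫ x in U, inner ℝ (weakRot U v x) (ψ x) = ∫ x in U, v x * rotVector ψ x

/-! ### Polygonal cells and meshes -/

/-- The open region enclosed by a simple polygon, with its boundary vertices listed in
counterclockwise order (indices are cyclic; angles of 180 degrees are allowed). -/
structure PolygonalCell where
  /-- The number of vertices is `m + 3`. -/
  m : ℕ
  vertex : Fin (m + 3) → E2
  /-- The open region. -/
  carrier : Set E2
  vertex_injective : Function.Injective vertex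
  simple : ∀ i j : Fin (m + 3), i ≠ j →
    segment ℝ (vertex i) (vertex (i + 1)) ∩ segment ℝ (vertex j) (vertex (j + 1)) ⊆
      {vertex i, vertex (i + 1)} ∩ {vertex j, vertex (j + 1)}
  isOpen_carrier : IsOpen carrier
  nonempty_carrier : carrier.Nonempty
  isBounded_carrier : Bornology.IsBounded carrier
  frontier_carrier : frontier carrier = ⋃ i, segment ℝ (vertex i) (vertex (i + 1))
  /-- The region lies to the left of each of its edges: the vector obtained by turning an edge
  clockwise by a right angle points outwards. -/
  counterclockwise : ∀ i : Fin (m + 3), ∀ x ∈ openSegment ℝ (vertex i) (vertex (i + 1)),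
    ∀ᶠ s : ℝ in 𝓝[>] 0,
      x - s • (!₂[vertex (i + 1) 1 - vertex i 1, vertex i 0 - vertex (i + 1) 0] : E2) ∈ carrier ∧
      x + s • (!₂[vertex (i + 1) 1 - vertex i 1, vertex i 0 - vertex (i + 1) 0] : E2) ∉ carrier

namespace PolygonalCell

variable (K : PolygonalCell)

/-- The `i`-th edge. -/
def edge (i : Fin (K.m + 3)) : Set E2 := segment ℝ (K.vertex i) (K.vertex (i + 1))

/-- The edge vector, of length the length of the edge and in the counterclockwise direction. -/
def edgeVec (i : Fin (K.m + 3)) : E2 := K.vertex (i + 1) - K.vertex i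

/-- The affine parametrization of the `i`-th edge by `[0, 1]`. -/
def edgePt (i : Fin (K.m + 3)) (s : ℝ) : E2 := K.vertex i + s • K.edgeVec i

/-- The divergence of `v` in the cell is `d`, and the outward normal component of `v` on the
`i`-th edge is `g i`, in the sense of Green's formula
`∫_K v · ∇φ + ∫_K d φ = ∑_e ∫_e g φ ds`. -/
def HasNormalTrace (v : E2 → E2) (d : E2 → ℝ) (g : Fin (K.m + 3) → E2 → ℝ) : Prop :=
  IsL2 K.carrier d ∧
  (∀ i, IntervalIntegrable (fun s => g i (K.edgePt i s)) volume 0 1) ∧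
  ∀ φ : E2 → ℝ, ContDiff ℝ ∞ φ →
    (∫ x in K.carrier, inner ℝ (v x) (grad φ x)) + ∫ x in K.carrier, d x * φ x =
      ∑ i, ‖K.edgeVec i‖ * ∫ s in (0 : ℝ)..1, g i (K.edgePt i s) * φ (K.edgePt i s)

/-- The rotor of `v` in the cell is `r`, and the trace of `v` on the boundary of the cell is the
continuous piecewise linear function with value `a i` at the `i`-th vertex, in the sense of
Green's formula `∫_K r · ψ = ∫_K v rot ψ - ∑_e ∫_e v ψ · t ds` (`t` the counterclockwise unit
tangent). -/
def HasLinearTrace (v : E2 → ℝ) (r : E2 → E2) (a : Fin (K.m + 3) → ℝ) : Prop :=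
  IsL2 K.carrier r ∧
  ∀ ψ : E2 → E2, ContDiff ℝ ∞ ψ →
    ∫ x in K.carrier, inner ℝ (r x) (ψ x) =
      (∫ x in K.carrier, v x * rotVector ψ x) -
        ∑ i, ∫ s in (0 : ℝ)..1,
          ((1 - s) * a i + s * a (i + 1)) * inner ℝ (ψ (K.edgePt i s)) (K.edgeVec i)

/-- The local nodal space: `v ∈ H(rot; K)`, the trace of `v` on the boundary is continuous and
linear on each edge, and `v` is harmonic (`rot rot v = -Δ v = 0`) in the cell. -/
def IsNodal (v : E2 → ℝ) : Prop :=
  IsL2 K.carrier v ∧ ∃ (r : E2 → E2) (a : Fin (K.m + 3) → ℝ),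
    K.HasLinearTrace v r a ∧ HasWeakRotZero K.carrier r

/-- `v` has the value `a i` at the `i`-th vertex of the cell. -/
def HasVertexValues (v : E2 → ℝ) (a : Fin (K.m + 3) → ℝ) : Prop :=
  ∃ r : E2 → E2, K.HasLinearTrace v r a

/-- The local edge space: `w ∈ H(div; K) ∩ H(rot; K)`, the normal component of `w` is constant
on each edge, `div w` is constant and `rot w = 0` in the cell. -/
def IsEdge (w : E2 → E2) : Prop :=
  IsL2 K.carrier w ∧ HasWeakRotZero K.carrier w ∧
    ∃ (d : ℝ) (k : Fin (K.m + 3) → ℝ), K.HasNormalTrace w (fun _ => d) (fun i _ => k i)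

/-- The outward normal component of `w` has the mean `q i` on the `i`-th edge. -/
def HasEdgeMeans (w : E2 → E2) (q : Fin (K.m + 3) → ℝ) : Prop :=
  ∃ (d : E2 → ℝ) (g : Fin (K.m + 3) → E2 → ℝ), K.HasNormalTrace w d g ∧
    ∀ i, q i = ∫ s in (0 : ℝ)..1, g i (K.edgePt i s)

/-- The barycentre of the cell. -/
def barycentre : E2 := ⨍ x in K.carrier, x

/-- The `L²(K)`-orthogonal projection onto the lowest-order Raviart–Thomas space
`{a + b x : a ∈ ℝ², b ∈ ℝ}`, in terms of the orthogonal decomposition of this space into the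
constants and the multiples of `x - barycentre` (see `rtProj_mem` and `rtProj_orthogonal`). -/
def rtProj (w : E2 → E2) (x : E2) : E2 :=
  (⨍ y in K.carrier, w y) +
    ((∫ y in K.carrier, inner ℝ (w y) (y - K.barycentre)) /
      ∫ y in K.carrier, ‖y - K.barycentre‖ ^ 2) • (x - K.barycentre)

theorem rtProj_mem (w : E2 → E2) : ∃ (a : E2) (b : ℝ), ∀ x, K.rtProj w x = a + b • x :=
  ⟨(⨍ y in K.carrier, w y) - ((∫ y in K.carrier, inner ℝ (w y) (y - K.barycentre)) /
      ∫ y in K.carrier, ‖y - K.barycentre‖ ^ 2) • K.barycentre, _, fun x => by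
    rw [rtProj, smul_sub]; abel⟩

theorem rtProj_orthogonal (w : E2 → E2) (hw : IsL2 K.carrier w) (a : E2) (b : ℝ) :
    ∫ x in K.carrier, inner ℝ (w x - K.rtProj w x) (a + b • x) = 0 := by
  set μ : Measure E2 := volume.restrict K.carrier with hμ
  have hfin : volume K.carrier ≠ ⊤ := K.isBounded_carrier.measure_lt_top.ne
  have : IsFiniteMeasure μ := ⟨by simpa [hμ] using K.isBounded_carrier.measure_lt_top⟩
  have : NeZero μ := ⟨by
    rw [hμ, Ne, Measure.restrict_eq_zero]
    exact (K.isOpen_carrier.measure_pos volume K.nonempty_carrier).ne'⟩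
  set p := K.barycentre with hp
  set c : E2 := ⨍ y in K.carrier, w y with hc
  set A : ℝ := ∫ y in K.carrier, inner ℝ (w y) (y - p) with hA
  set D : ℝ := ∫ y in K.carrier, ‖y - p‖ ^ 2 with hD
  obtain ⟨C, hC⟩ := K.isBounded_carrier.exists_norm_le
  have hid : MemLp (fun x : E2 => x) 2 μ := by
    refine MemLp.of_bound (by fun_prop) C ?_
    exact (ae_restrict_iff' K.isOpen_carrier.measurableSet).2 (ae_of_all _ hC)
  have hz : MemLp (fun x : E2 => x - p) 2 μ := hid.sub (memLp_const p)
  have hwc : MemLp (fun x => w x - c) 2 μ := MemLp.sub hw (memLp_const c)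
  have hwi : Integrable w μ := MemLp.integrable (by norm_num) hw
  have hzi : Integrable (fun x : E2 => x - p) μ := hz.integrable (by norm_num)
  have hwci : Integrable (fun x => w x - c) μ := hwc.integrable (by norm_num)
  have hz2 : Integrable (fun x : E2 => ‖x - p‖ ^ 2) μ := hz.integrable_norm_pow (by norm_num)
  have hwz : Integrable (fun x => inner ℝ (w x) (x - p)) μ := by
    have := L2.integrable_inner (𝕜 := ℝ) (hw.toLp w) (hz.toLp _)
    refine this.congr ?_
    filter_upwards [hw.coeFn_toLp, hz.coeFn_toLp] with x h1 h2
    rw [h1, h2]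
  have iz : ∫ x, (x - p) ∂μ = 0 := by
    have := integral_sub_average μ (fun x : E2 => x)
    simpa [hp, barycentre] using this
  have iw : ∫ x, (w x - c) ∂μ = 0 := integral_sub_average μ w
  have key : A - A / D * D = 0 := by
    by_cases h0 : D = 0
    · have hz0 : (fun x : E2 => ‖x - p‖ ^ 2) =ᵐ[μ] 0 :=
        (integral_eq_zero_iff_of_nonneg (fun x => by positivity) hz2).1 h0
      have : A = 0 := by
        rw [hA]
        refine integral_eq_zero_of_ae ?_
        filter_upwards [hz0] with x hx
        have : x - p = 0 := by simpa using hx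
        simp [this]
      simp [this]
    · field_simp; simp
  have e : ∀ x, inner ℝ (w x - K.rtProj w x) (a + b • x) =
      inner ℝ (a + b • p) (w x - c) - A / D * inner ℝ (a + b • p) (x - p)
        + b * (inner ℝ (w x) (x - p) - inner ℝ c (x - p) - A / D * ‖x - p‖ ^ 2) := by
    intro x
    have h1 : w x - K.rtProj w x = w x - c - (A / D) • (x - p) := by
      rw [rtProj]; abel
    have h2 : a + b • x = (a + b • p) + b • (x - p) := by rw [smul_sub]; abel
    rw [h1, h2, inner_add_right, inner_smul_right, inner_sub_left (w x - c),
      inner_sub_left (w x - c) _ (x - p), real_inner_smul_left, real_inner_smul_left,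
      real_inner_self_eq_norm_sq, inner_sub_left (w x) c (x - p),
      real_inner_comm (a + b • p) (w x - c), real_inner_comm (a + b • p) (x - p)]
  have j1 : Integrable (fun x => inner ℝ (a + b • p) (w x - c)) μ := hwci.const_inner _
  have j2 : Integrable (fun x => inner ℝ (a + b • p) (x - p)) μ := hzi.const_inner _
  have j3 : Integrable (fun x => inner ℝ c (x - p)) μ := hzi.const_inner _
  have j4 : Integrable (fun x => inner ℝ (w x) (x - p) - inner ℝ c (x - p)) μ := hwz.sub j3
  have j5 : Integrable (fun x => inner ℝ (a + b • p) (w x - c)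
      - A / D * inner ℝ (a + b • p) (x - p)) μ := j1.sub (j2.const_mul _)
  have j6 : Integrable (fun x => inner ℝ (w x) (x - p) - inner ℝ c (x - p)
      - A / D * ‖x - p‖ ^ 2) μ := j4.sub (hz2.const_mul _)
  simp_rw [e]
  rw [integral_add j5 (j6.const_mul _), integral_sub j1 (j2.const_mul _), integral_const_mul,
    integral_const_mul, integral_sub j4 (hz2.const_mul _), integral_sub hwz j3, integral_const_mul,
    integral_inner hwci, integral_inner hzi, integral_inner hzi, iz, iw]
  simp only [inner_zero_right, mul_zero, sub_zero, zero_add]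
  rw [key, mul_zero]

end PolygonalCell

/-- A conforming decomposition of the planar set `Ω` into finitely many polygonal cells. The first
field excludes slits and isolated boundary points and makes `Ω` open. -/
structure PolygonalMesh (Ω : Set E2) where
  interior_closure : interior (closure Ω) = Ω
  numCells : ℕ
  cell : Fin numCells → PolygonalCell
  cover : closure Ω = ⋃ c, closure (cell c).carrier
  disjoint : ∀ c c', c ≠ c' → Disjoint (cell c).carrier (cell c').carrier
  conforming : ∀ c c', c ≠ c' → ∀ i j,
    (cell c).edge i = (cell c').edge j ∨
    (cell c).edge i ∩ (cell c').edge j ⊆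
      {(cell c).vertex i, (cell c).vertex (i + 1)} ∩ {(cell c').vertex j, (cell c').vertex (j + 1)}

namespace PolygonalMesh

variable {Ω : Set E2} (M : PolygonalMesh Ω)

/-! ### The global spaces and the interpolation operators -/

/-- The nodal space `V_h`. -/
def IsNodal (v : E2 → ℝ) : Prop := IsHRot Ω v ∧ ∀ c, (M.cell c).IsNodal v

/-- The nodal space `V_{h,0}` with zero boundary values. -/
def IsNodalZero (v : E2 → ℝ) : Prop := M.IsNodal v ∧ HasZeroTrace Ω v

/-- The edge space `E_h`. -/
def IsEdge (w : E2 → E2) : Prop := IsHDiv Ω w ∧ ∀ c, (M.cell c).IsEdge w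

/-- `v` is the interpolant in `V_h` of a function with values `f` at the mesh vertices: `v ∈ V_h`
has the same vertex values. -/
def IsNodalInterpolant (f : E2 → ℝ) (v : E2 → ℝ) : Prop :=
  M.IsNodal v ∧ ∀ c, (M.cell c).HasVertexValues v (fun i => f ((M.cell c).vertex i))

/-- `w` is the interpolant in `E_h` of the vector field `F`: `w ∈ E_h` has the same mean normal
component on each edge. -/
def IsEdgeInterpolant (F : E2 → E2) (w : E2 → E2) : Prop :=
  M.IsEdge w ∧ ∀ c, ∃ q, (M.cell c).HasEdgeMeans F q ∧ (M.cell c).HasEdgeMeans w q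

/-- `x` is a vertex of the cell `c`. -/
def IsVertexOf (c : Fin M.numCells) (x : E2) : Prop := x ∈ range (M.cell c).vertex

/-- Weights which attribute to a cellwise continuous function one value at each mesh vertex, as a
weighted mean of the values from the cells that share the vertex. -/
structure VertexWeights where
  weight : Fin M.numCells → E2 → ℝ
  nonneg : ∀ c x, 0 ≤ weight c x
  eq_zero : ∀ c x, ¬ M.IsVertexOf c x → weight c x = 0
  sum_eq_one : ∀ x, (∃ c, M.IsVertexOf c x) → ∑ c, weight c x = 1

/-- The vertex values of `u × Π^{RT} w`. -/
def crossVertexValue (ϖ : M.VertexWeights) (u : E2 → E2) (w : E2 → E2) (x : E2) : ℝ :=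
  ∑ c, ϖ.weight c x * cross (u x) ((M.cell c).rtProj w x)

/-! ### The discrete inner products -/

/-- A stabilization for the inner product of the edge space: on each cell a symmetric bilinear
form that, on the functions `w - Π^{RT} w` with `w` in the local edge space, is comparable to the
`L²` inner product. -/
structure EdgeStabilization where
  form : Fin M.numCells → LinearMap.BilinForm ℝ (E2 → E2)
  symm : ∀ c v w, form c v w = form c w v
  lower : ℝ
  upper : ℝ
  lower_pos : 0 < lower
  lower_bound : ∀ c w, (M.cell c).IsEdge w →
    lower * ∫ x in (M.cell c).carrier, ‖w x - (M.cell c).rtProj w x‖ ^ 2 ≤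
      form c (w - (M.cell c).rtProj w) (w - (M.cell c).rtProj w)
  upper_bound : ∀ c w, (M.cell c).IsEdge w →
    form c (w - (M.cell c).rtProj w) (w - (M.cell c).rtProj w) ≤
      upper * ∫ x in (M.cell c).carrier, ‖w x - (M.cell c).rtProj w x‖ ^ 2

/-- The inner product of the edge space. -/
def edgeInner (S : M.EdgeStabilization) (v w : E2 → E2) : ℝ :=
  ∑ c, ((∫ x in (M.cell c).carrier, inner ℝ ((M.cell c).rtProj v x) ((M.cell c).rtProj w x)) +
    S.form c (v - (M.cell c).rtProj v) (w - (M.cell c).rtProj w))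

/-- The ingredients of the inner product of the nodal space: on each cell a linear reconstruction
`recon` that is exact on affine functions, and a symmetric positive semidefinite stabilization
`form` such that the resulting inner product is comparable to the `L²` inner product. -/
structure NodalStabilization where
  recon : Fin M.numCells → (E2 → ℝ) →ₗ[ℝ] (E2 → ℝ)
  form : Fin M.numCells → LinearMap.BilinForm ℝ (E2 → ℝ)
  recon_isL2 : ∀ c v, (M.cell c).IsNodal v → IsL2 (M.cell c).carrier (recon c v)
  recon_affine : ∀ c (a : ℝ) (b : E2), ∀ᵐ x ∂(volume.restrict (M.cell c).carrier),
    recon c (fun y => a + inner ℝ b y) x = a + inner ℝ b x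
  symm : ∀ c v w, form c v w = form c w v
  nonneg : ∀ c v, (M.cell c).IsNodal v → 0 ≤ form c (v - recon c v) (v - recon c v)
  lower : ℝ
  upper : ℝ
  lower_pos : 0 < lower
  lower_bound : ∀ c v, (M.cell c).IsNodal v →
    lower * ∫ x in (M.cell c).carrier, v x ^ 2 ≤
      (∫ x in (M.cell c).carrier, recon c v x ^ 2) + form c (v - recon c v) (v - recon c v)
  upper_bound : ∀ c v, (M.cell c).IsNodal v →
    (∫ x in (M.cell c).carrier, recon c v x ^ 2) + form c (v - recon c v) (v - recon c v) ≤
      upper * ∫ x in (M.cell c).carrier, v x ^ 2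

/-- The inner product of the nodal space. -/
def nodalInner (R : M.NodalStabilization) (v w : E2 → ℝ) : ℝ :=
  ∑ c, ((∫ x in (M.cell c).carrier, R.recon c v x * R.recon c w x) +
    R.form c (v - R.recon c v) (w - R.recon c w))

/-! ### The scheme -/

/-- The `n`-th time step of the virtual element scheme. Here `B₁` and `B₂` are the magnetic flux
fields at the times `t^n` and `t^{n+1} = t^n + Δt`, `Ehat` is the unknown part of the electric
field, with zero boundary values, and `E₀` is the given electric field, all at the time
`t^{n+θ}`. The electric field is `Ehat + I₀`, where `I₀` is the interpolant of `E₀` in `V_h`, and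
`J` is the interpolant in `V_h` of `u × Π^{RT} (θ B₂ + (1 - θ) B₁)`. -/
def IsStep (S : M.EdgeStabilization) (R : M.NodalStabilization) (ϖ : M.VertexWeights)
    (u : E2 → E2) (θ Δt : ℝ) (E₀ : E2 → ℝ) (B₁ B₂ : E2 → E2) (Ehat : E2 → ℝ) : Prop :=
  ∃ I₀ J : E2 → ℝ,
    M.IsNodalInterpolant E₀ I₀ ∧
    M.IsNodalInterpolant (M.crossVertexValue ϖ u (θ • B₂ + (1 - θ) • B₁)) J ∧
    (∀ w, M.IsEdge w →
      M.edgeInner S (Δt⁻¹ • (B₂ - B₁)) w + M.edgeInner S (weakRot Ω (Ehat + I₀)) w = 0) ∧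
    (∀ v, M.IsNodalZero v →
      M.nodalInner R (Ehat + I₀) v + M.nodalInner R J v
        - M.edgeInner S (θ • B₂ + (1 - θ) • B₁) (weakRot Ω v) = 0)

/-- `B n` (`0 ≤ n ≤ N`) and `Ehat n` (`0 ≤ n < N`, the unknown at the time `(n + θ) Δt`) solve the
virtual element scheme with initial field `B₀`. -/
structure IsSolution (S : M.EdgeStabilization) (R : M.NodalStabilization) (ϖ : M.VertexWeights)
    (u : E2 → E2) (θ Δt : ℝ) (N : ℕ) (E₀ : ℝ → E2 → ℝ) (B₀ : E2 → E2)
    (B : ℕ → E2 → E2) (Ehat : ℕ → E2 → ℝ) : Prop where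
  edge : ∀ n ≤ N, M.IsEdge (B n)
  nodal : ∀ n < N, M.IsNodalZero (Ehat n)
  initial : M.IsEdgeInterpolant B₀ (B 0)
  step : ∀ n < N, M.IsStep S R ϖ u θ Δt (E₀ ((n + θ) * Δt)) (B n) (B (n + 1)) (Ehat n)

end PolygonalMesh

end VEM

end

/-! Faraday's law, imposed weakly against `E_h`, in fact holds almost everywhere. The rotor of a
nodal function belongs to `E_h` (`IsNodal.isEdge_weakRot`): on a cell, integration by parts along
the edges turns the linear trace into a constant normal component, the divergence of a rotor is
zero, and harmonicity says that the rotor of the rotor vanishes. Hence the residual `(B₂ - B₁)/Δt +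
rot E` is an admissible test field. Tested with itself it is zero, because the discrete inner
product is definite (`IsEdge.ae_eq_zero_of_edgeInner_self`). Each step therefore changes the
magnetic field by a multiple of a rotor, which is divergence free since mixed derivatives commute.

Initially, the divergence of the interpolant is constant on each cell and, by Green's formula with
test function 1, is determined by the edge fluxes. These are the fluxes of a divergence-free field,
so the constant is 0. Membership in `H(div)` passes from the cells to `Ω`, and induction on time
concludes. -/

namespace VEM

/-! ### Square integrable functions and test functions -/

section Integrability

variable {F : Type*} [NormedAddCommGroup F] {U V : Set E2}

theorem IsL2.mono {v : E2 → F} (h : IsL2 V v) (hUV : U ⊆ V) : IsL2 U v :=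
  h.mono_measure (Measure.restrict_mono hUV le_rfl)

theorem IsL2.integrableOn_inner [InnerProductSpace ℝ F] {v w : E2 → F}
    (hv : IsL2 U v) (hw : IsL2 U w) :
    IntegrableOn (fun x => (inner ℝ (v x) (w x) : ℝ)) U := by
  refine (L2.integrable_inner (𝕜 := ℝ) (hv.toLp v) (hw.toLp w)).congr ?_
  filter_upwards [hv.coeFn_toLp, hw.coeFn_toLp] with x h1 h2
  rw [h1, h2]

theorem IsL2.integrableOn_mul {v w : E2 → ℝ} (hv : IsL2 U v) (hw : IsL2 U w) :
    IntegrableOn (fun x => v x * w x) U :=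
  MemLp.integrable_mul hv hw

theorem IsL2.integrableOn {v : E2 → F} (hv : IsL2 U v) (hU : Bornology.IsBounded U) :
    IntegrableOn v U := by
  have : IsFiniteMeasure (volume.restrict U) := ⟨by simpa using hU.measure_lt_top⟩
  exact MemLp.integrable (by norm_num) hv

/-- The test functions of Green's formula on a cell need not vanish at its boundary; compactness of
the closure replaces compact support. -/
theorem isL2_of_continuous {v : E2 → F} (hv : Continuous v) (hU : Bornology.IsBounded U) :
    IsL2 U v := by
  have : IsFiniteMeasure (volume.restrict (closure U)) :=
    ⟨by simpa using hU.isCompact_closure.measure_lt_top⟩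
  obtain ⟨C, hC⟩ := hU.isCompact_closure.exists_bound_of_continuousOn hv.continuousOn
  refine IsL2.mono (V := closure U) ?_ subset_closure
  refine MemLp.of_bound (hv.aestronglyMeasurable) C ?_
  exact (ae_restrict_iff' isClosed_closure.measurableSet).2 (ae_of_all _ hC)

theorem IsTest.isL2 [NormedSpace ℝ F] {φ : E2 → F} (h : IsTest V φ) : IsL2 U φ :=
  h.1.continuous.memLp_of_hasCompactSupport h.2.1

theorem IsTest.mono [NormedSpace ℝ F] {φ : E2 → F} (h : IsTest U φ) (hUV : U ⊆ V) : IsTest V φ :=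
  ⟨h.1, h.2.1, h.2.2.trans hUV⟩

end Integrability

/-! ### Classical differential operators and their action on test functions -/

section Derivatives

variable {U : Set E2} {φ : E2 → ℝ} {ψ : E2 → E2}

theorem contDiff_pderiv (i : Fin 2) (h : ContDiff ℝ ∞ φ) : ContDiff ℝ ∞ (pderiv i φ) :=
  (h.fderiv_right (m := ∞) (by simp)).clm_apply contDiff_const

theorem contDiff_grad (h : ContDiff ℝ ∞ φ) : ContDiff ℝ ∞ (grad φ) := by
  rw [contDiff_euclidean]
  intro i
  fin_cases i
  · exact contDiff_pderiv 0 h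
  · exact contDiff_pderiv 1 h

theorem contDiff_rotScalar (h : ContDiff ℝ ∞ φ) : ContDiff ℝ ∞ (rotScalar φ) := by
  rw [contDiff_euclidean]
  intro i
  fin_cases i
  · exact contDiff_pderiv 1 h
  · exact (contDiff_pderiv 0 h).neg

theorem contDiff_rotVector (h : ContDiff ℝ ∞ ψ) : ContDiff ℝ ∞ (rotVector ψ) :=
  (contDiff_pderiv 0 (contDiff_euclidean.1 h 1)).sub (contDiff_pderiv 1 (contDiff_euclidean.1 h 0))

theorem pderiv_eq_zero_of_notMem_tsupport {x : E2} (i : Fin 2) (hx : x ∉ tsupport φ) :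
    pderiv i φ x = 0 := by
  simp [pderiv, fderiv_of_notMem_tsupport ℝ hx]

theorem pderiv_comp_eq_zero_of_notMem_tsupport {x : E2} (i j : Fin 2) (hx : x ∉ tsupport ψ) :
    pderiv i (fun y => ψ y j) x = 0 := by
  refine pderiv_eq_zero_of_notMem_tsupport i fun h => hx ?_
  have hs : Function.support (fun y => ψ y j) ⊆ Function.support ψ :=
    fun y hy hy' => hy (by simp [hy'])
  exact closure_mono hs h

theorem IsTest.of_eq_zero {F G : Type*} [NormedAddCommGroup F] [NormedSpace ℝ F]
    [NormedAddCommGroup G] [NormedSpace ℝ G] {f : E2 → F} {g : E2 → G} (hf : IsTest U f)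
    (hg : ContDiff ℝ ∞ g) (h : ∀ x ∉ tsupport f, g x = 0) : IsTest U g := by
  have hs : tsupport g ⊆ tsupport f :=
    closure_minimal (fun x hx => by_contra fun hx' => hx (h x hx')) isClosed_closure
  exact ⟨hg, hf.2.1.of_isClosed_subset isClosed_closure hs, hs.trans hf.2.2⟩

theorem IsTest.grad (h : IsTest U φ) : IsTest U (grad φ) :=
  h.of_eq_zero (contDiff_grad h.1) fun x hx => by
    ext i
    fin_cases i
    · exact pderiv_eq_zero_of_notMem_tsupport 0 hx
    · exact pderiv_eq_zero_of_notMem_tsupport 1 hx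

theorem IsTest.rotScalar (h : IsTest U φ) : IsTest U (rotScalar φ) :=
  h.of_eq_zero (contDiff_rotScalar h.1) fun x hx => by
    ext i
    fin_cases i
    · exact pderiv_eq_zero_of_notMem_tsupport 1 hx
    · exact neg_eq_zero.2 (pderiv_eq_zero_of_notMem_tsupport 0 hx)

theorem IsTest.rotVector (h : IsTest U ψ) : IsTest U (rotVector ψ) :=
  h.of_eq_zero (contDiff_rotVector h.1) fun x hx => by
    simp [VEM.rotVector, pderiv_comp_eq_zero_of_notMem_tsupport _ _ hx]

theorem IsTest.smul_const (h : IsTest U φ) (e : E2) : IsTest U (fun x => φ x • e) :=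
  h.of_eq_zero (h.1.smul contDiff_const) fun x hx => by simp [image_eq_zero_of_notMem_tsupport hx]

/-- Equality of mixed second derivatives. By duality it yields `div rot = 0` for weak rotors. -/
theorem rotVector_grad (h : ContDiff ℝ ∞ φ) (x : E2) : rotVector (grad φ) x = 0 := by
  have hs : IsSymmSndFDerivAt ℝ φ x :=
    h.contDiffAt.isSymmSndFDerivAt (by simpa using WithTop.coe_le_coe.2 (le_top (a := (2 : ℕ∞))))
  have hd : DifferentiableAt ℝ (fderiv ℝ φ) x :=
    ((h.fderiv_right (m := ∞) (by simp)).differentiable (by simp)).differentiableAt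
  have e (i j : Fin 2) : pderiv i (pderiv j φ) x =
      fderiv ℝ (fderiv ℝ φ) x (EuclideanSpace.single i 1) (EuclideanSpace.single j 1) := by
    have := hd.hasFDerivAt.clm_apply (hasFDerivAt_const (EuclideanSpace.single j (1 : ℝ)) x)
    change fderiv ℝ (fun y => fderiv ℝ φ y (EuclideanSpace.single j 1)) x _ = _
    rw [this.fderiv]
    simp
  change pderiv 0 (pderiv 1 φ) x - pderiv 1 (pderiv 0 φ) x = 0
  rw [e, e, hs.eq, sub_self]

/-- Links the coordinate gradient to the Fréchet derivative, so that the chain rule applies along an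
edge. -/
theorem inner_grad (φ : E2 → ℝ) (x e : E2) : inner ℝ (grad φ x) e = fderiv ℝ φ x e := by
  have he : e = e 0 • EuclideanSpace.single 0 (1 : ℝ) + e 1 • EuclideanSpace.single 1 (1 : ℝ) := by
    ext i
    fin_cases i <;> simp
  conv_rhs => rw [he, map_add, map_smul, map_smul]
  simp [grad, pderiv, PiLp.inner_apply, Fin.sum_univ_two]

end Derivatives

/-! ### Weak derivatives -/

section Weak

variable {U V : Set E2}

/-- The fundamental lemma of the calculus of variations. It makes weak derivatives unique, so that
divergences and rotors obtained from different definitions can be identified. -/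
theorem IsL2.ae_eq_zero_of_integral_test {d : E2 → ℝ} (hU : IsOpen U) (hd : IsL2 U d)
    (h : ∀ φ : E2 → ℝ, IsTest U φ → ∫ x in U, d x * φ x = 0) :
    d =ᵐ[volume.restrict U] 0 := by
  have hloc : LocallyIntegrableOn d U :=
    locallyIntegrableOn_of_locallyIntegrable_restrict (MemLp.locallyIntegrable hd (by norm_num))
  refine (ae_restrict_iff' hU.measurableSet).2
    (hU.ae_eq_zero_of_integral_contDiff_smul_eq_zero hloc fun g h1 h2 h3 => ?_)
  rw [← h g ⟨h1, h2, h3⟩, setIntegral_eq_integral_of_forall_compl_eq_zero]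
  · simp [mul_comm]
  · intro x hx
    rw [image_eq_zero_of_notMem_tsupport fun hx' => hx (h3 hx'), mul_zero]

theorem setIntegral_eq_of_tsupport_subset {f : E2 → ℝ} {F : Type*} [NormedAddCommGroup F]
    {φ : E2 → F} (hV : MeasurableSet V) (hUV : U ⊆ V) (hφ : tsupport φ ⊆ U)
    (h : ∀ x, φ x = 0 → f x = 0) : ∫ x in V, f x = ∫ x in U, f x :=
  setIntegral_eq_of_subset_of_forall_sdiff_eq_zero hV hUV fun x hx =>
    h x (image_eq_zero_of_notMem_tsupport fun hx' => hx.2 (hφ hx'))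

theorem HasWeakDiv.mono {v : E2 → E2} {d : E2 → ℝ} (h : HasWeakDiv V v d) (hV : MeasurableSet V)
    (hUV : U ⊆ V) : HasWeakDiv U v d := by
  intro φ hφ
  have h1 := setIntegral_eq_of_tsupport_subset (f := fun x => inner ℝ (v x) (grad φ x)) hV hUV
    hφ.grad.2.2 (fun x hx => by simp [hx])
  have h2 := setIntegral_eq_of_tsupport_subset (f := fun x => d x * φ x) hV hUV hφ.2.2
    (fun x hx => by simp [hx])
  rw [← h1, ← h2]
  exact h φ (hφ.mono hUV)

theorem HasWeakRot.mono {v : E2 → ℝ} {r : E2 → E2} (h : HasWeakRot V v r) (hV : MeasurableSet V)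
    (hUV : U ⊆ V) : HasWeakRot U v r := by
  intro ψ hψ
  have h1 := setIntegral_eq_of_tsupport_subset (f := fun x => inner ℝ (r x) (ψ x)) hV hUV
    hψ.2.2 (fun x hx => by simp [hx])
  have h2 := setIntegral_eq_of_tsupport_subset (f := fun x => v x * rotVector ψ x) hV hUV
    hψ.rotVector.2.2 (fun x hx => by simp [hx])
  rw [← h1, ← h2]
  exact h ψ (hψ.mono hUV)

theorem HasWeakDiv.unique {v : E2 → E2} {d d' : E2 → ℝ} (h : HasWeakDiv U v d)
    (h' : HasWeakDiv U v d') (hU : IsOpen U) (hd : IsL2 U d) (hd' : IsL2 U d') :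
    d =ᵐ[volume.restrict U] d' := by
  have := IsL2.ae_eq_zero_of_integral_test hU (MemLp.sub hd hd') fun φ hφ => by
    simp only [Pi.sub_apply, sub_mul]
    rw [integral_sub (hd.integrableOn_mul hφ.isL2) (hd'.integrableOn_mul hφ.isL2), sub_eq_zero]
    exact neg_injective ((h φ hφ).symm.trans (h' φ hφ))
  filter_upwards [this] with x hx using sub_eq_zero.1 hx

theorem HasWeakRot.unique {v : E2 → ℝ} {r r' : E2 → E2} (h : HasWeakRot U v r)
    (h' : HasWeakRot U v r') (hU : IsOpen U) (hr : IsL2 U r) (hr' : IsL2 U r') :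
    r =ᵐ[volume.restrict U] r' := by
  have key (i : Fin 2) : (fun x => (r - r') x i) =ᵐ[volume.restrict U] 0 := by
    have hri : IsL2 U fun x => (r - r') x i :=
      (EuclideanSpace.proj (𝕜 := ℝ) i).comp_memLp' (MemLp.sub hr hr')
    refine IsL2.ae_eq_zero_of_integral_test hU hri fun φ hφ => ?_
    -- A scalar test function times a coordinate vector isolates one component and reduces the claim
    -- to the scalar case.
    have hψ := hφ.smul_const (EuclideanSpace.single i 1)
    have e (x : E2) : (r - r') x i * φ x = inner ℝ (r x) (φ x • EuclideanSpace.single i (1 : ℝ))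
        - inner ℝ (r' x) (φ x • EuclideanSpace.single i (1 : ℝ)) := by
      rw [← inner_sub_left, inner_smul_right, EuclideanSpace.inner_single_right]
      simp [mul_comm]
    simp_rw [e]
    rw [integral_sub (hr.integrableOn_inner hψ.isL2) (hr'.integrableOn_inner hψ.isL2), sub_eq_zero]
    exact (h _ hψ).trans (h' _ hψ).symm
  filter_upwards [key 0, key 1] with x h0 h1
  ext i
  fin_cases i
  · exact sub_eq_zero.1 h0
  · exact sub_eq_zero.1 h1

theorem HasWeakDiv.congr {v w : E2 → E2} {d e : E2 → ℝ} (h : HasWeakDiv U v d)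
    (hv : v =ᵐ[volume.restrict U] w) (hd : d =ᵐ[volume.restrict U] e) : HasWeakDiv U w e := by
  intro φ hφ
  have h1 : ∫ x in U, inner ℝ (w x) (VEM.grad φ x) = ∫ x in U, inner ℝ (v x) (VEM.grad φ x) :=
    integral_congr_ae (by filter_upwards [hv] with x hx; rw [hx])
  have h2 : ∫ x in U, e x * φ x = ∫ x in U, d x * φ x :=
    integral_congr_ae (by filter_upwards [hd] with x hx; rw [hx])
  rw [h1, h2]
  exact h φ hφ

theorem HasWeakDiv.add {v w : E2 → E2} {d e : E2 → ℝ} (hv : HasWeakDiv U v d)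
    (hw : HasWeakDiv U w e) (hv2 : IsL2 U v) (hw2 : IsL2 U w) (hd : IsL2 U d) (he : IsL2 U e) :
    HasWeakDiv U (v + w) (d + e) := by
  intro φ hφ
  simp only [Pi.add_apply, inner_add_left, add_mul]
  rw [integral_add (hv2.integrableOn_inner hφ.grad.isL2) (hw2.integrableOn_inner hφ.grad.isL2),
    integral_add (hd.integrableOn_mul hφ.isL2) (he.integrableOn_mul hφ.isL2), hv φ hφ, hw φ hφ]
  ring

theorem HasWeakDiv.smul {v : E2 → E2} {d : E2 → ℝ} (c : ℝ) (hv : HasWeakDiv U v d) :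
    HasWeakDiv U (c • v) (c • d) := by
  intro φ hφ
  simp only [Pi.smul_apply, real_inner_smul_left, smul_eq_mul, mul_assoc]
  rw [integral_const_mul, integral_const_mul, hv φ hφ]
  ring

theorem HasWeakRotZero.congr {v w : E2 → E2} (h : HasWeakRotZero U v)
    (hv : v =ᵐ[volume.restrict U] w) : HasWeakRotZero U w := by
  intro φ hφ
  rw [← h φ hφ]
  exact integral_congr_ae (by filter_upwards [hv] with x hx; rw [hx])

theorem HasWeakRotZero.add {v w : E2 → E2} (hv : HasWeakRotZero U v)
    (hw : HasWeakRotZero U w) (hv2 : IsL2 U v) (hw2 : IsL2 U w) : HasWeakRotZero U (v + w) := by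
  intro φ hφ
  simp only [Pi.add_apply, inner_add_left]
  rw [integral_add (hv2.integrableOn_inner hφ.rotScalar.isL2)
    (hw2.integrableOn_inner hφ.rotScalar.isL2), hv φ hφ, hw φ hφ, add_zero]

theorem HasWeakRotZero.smul {v : E2 → E2} (c : ℝ) (hv : HasWeakRotZero U v) :
    HasWeakRotZero U (c • v) := by
  intro φ hφ
  simp only [Pi.smul_apply, real_inner_smul_left]
  rw [integral_const_mul, hv φ hφ, mul_zero]

theorem HasWeakRot.add {v w : E2 → ℝ} {r s : E2 → E2} (hv : HasWeakRot U v r)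
    (hw : HasWeakRot U w s) (hv2 : IsL2 U v) (hw2 : IsL2 U w) (hr : IsL2 U r) (hs : IsL2 U s) :
    HasWeakRot U (v + w) (r + s) := by
  intro ψ hψ
  simp only [Pi.add_apply, inner_add_left, add_mul]
  rw [integral_add (hr.integrableOn_inner hψ.isL2) (hs.integrableOn_inner hψ.isL2),
    integral_add (hv2.integrableOn_mul hψ.rotVector.isL2) (hw2.integrableOn_mul hψ.rotVector.isL2),
    hv ψ hψ, hw ψ hψ]

/-- The weak rotor of a scalar function is divergence free. -/
theorem HasWeakRot.hasWeakDiv {v : E2 → ℝ} {r : E2 → E2} (h : HasWeakRot U v r) :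
    HasWeakDiv U r 0 := by
  intro φ hφ
  -- The gradient of a test function is itself an admissible vector test field.
  rw [h _ hφ.grad]
  simp [rotVector_grad hφ.1]

/-- Membership in `H(rot)` excludes the default value 0 of `weakRot`. -/
theorem IsHRot.weakRot_spec {v : E2 → ℝ} (h : IsHRot U v) :
    IsL2 U (weakRot U v) ∧ HasWeakRot U v (weakRot U v) := by
  rw [weakRot, dif_pos h.2]
  exact h.2.choose_spec

theorem IsHRot.add {v w : E2 → ℝ} (hv : IsHRot U v) (hw : IsHRot U w) : IsHRot U (v + w) := by
  obtain ⟨hv2, r, hr2, hr⟩ := hv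
  obtain ⟨hw2, s, hs2, hs⟩ := hw
  exact ⟨MemLp.add hv2 hw2, r + s, MemLp.add hr2 hs2, hr.add hs hv2 hw2 hr2 hs2⟩

theorem IsHDiv.add {v w : E2 → E2} (hv : IsHDiv U v) (hw : IsHDiv U w) : IsHDiv U (v + w) := by
  obtain ⟨hv2, d, hd2, hd⟩ := hv
  obtain ⟨hw2, e, he2, he⟩ := hw
  exact ⟨MemLp.add hv2 hw2, d + e, MemLp.add hd2 he2, hd.add he hv2 hw2 hd2 he2⟩

theorem IsHDiv.smul {v : E2 → E2} (c : ℝ) (hv : IsHDiv U v) : IsHDiv U (c • v) := by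
  obtain ⟨hv2, d, hd2, hd⟩ := hv
  exact ⟨MemLp.const_smul hv2 c, c • d, MemLp.const_smul hd2 c, hd.smul c⟩

end Weak

/-! ### Traces and local spaces on a cell -/

theorem volume_segment (a b : E2) : volume (segment ℝ a b) = 0 := by
  -- The line through two points has direction of dimension at most 1, so it is a proper affine
  -- subspace of the plane and hence null.
  have hne : line[ℝ, a, b] ≠ ⊤ := by
    intro h
    have h1 := (collinear_iff_finrank_le_one (k := ℝ)).1 (collinear_pair ℝ a b)
    rw [← direction_affineSpan, h, AffineSubspace.direction_top, finrank_top] at h1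
    simp at h1
  refine measure_mono_null ?_ (Measure.addHaar_affineSubspace volume _ hne)
  rw [← convexHull_pair]
  exact convexHull_subset_affineSpan _

namespace PolygonalCell

variable (K : PolygonalCell)

theorem measurableSet_carrier : MeasurableSet K.carrier := K.isOpen_carrier.measurableSet

theorem volume_frontier : volume (frontier K.carrier) = 0 := by
  rw [K.frontier_carrier]
  exact measure_iUnion_null fun i => volume_segment _ _

theorem edgePt_mem_edge (i : Fin (K.m + 3)) {s : ℝ} (hs : s ∈ Icc (0 : ℝ) 1) :
    K.edgePt i s ∈ K.edge i := by
  rw [edge, segment_eq_image']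
  exact ⟨s, hs, rfl⟩

theorem edgePt_notMem_carrier (i : Fin (K.m + 3)) {s : ℝ} (hs : s ∈ Icc (0 : ℝ) 1) :
    K.edgePt i s ∉ K.carrier := by
  have h : K.edgePt i s ∈ frontier K.carrier := by
    rw [K.frontier_carrier]
    exact mem_iUnion.2 ⟨i, K.edgePt_mem_edge i hs⟩
  rw [K.isOpen_carrier.frontier_eq] at h
  exact h.2

theorem edgeVec_ne_zero (i : Fin (K.m + 3)) : K.edgeVec i ≠ 0 := by
  rw [edgeVec, sub_ne_zero]
  intro h
  -- Injectivity would give `i + 1 = i`, impossible modulo `m + 3`.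
  simpa using K.vertex_injective h

@[fun_prop]
theorem continuous_edgePt (i : Fin (K.m + 3)) : Continuous (K.edgePt i) := by
  unfold edgePt
  fun_prop

variable {K}

theorem edgePt_eq_zero_of_isTest {F : Type*} [NormedAddCommGroup F] [NormedSpace ℝ F] {φ : E2 → F}
    (h : IsTest K.carrier φ) (i : Fin (K.m + 3)) {s : ℝ} (hs : s ∈ uIcc (0 : ℝ) 1) :
    φ (K.edgePt i s) = 0 := by
  rw [uIcc_of_le zero_le_one] at hs
  exact image_eq_zero_of_notMem_tsupport fun h' => K.edgePt_notMem_carrier i hs (h.2.2 h')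

/-- The edges lie outside the open cell, so a test function supported in the cell kills every
boundary term. -/
theorem HasNormalTrace.hasWeakDiv {v : E2 → E2} {d : E2 → ℝ} {g : Fin (K.m + 3) → E2 → ℝ}
    (h : K.HasNormalTrace v d g) : HasWeakDiv K.carrier v d := by
  intro φ hφ
  refine eq_neg_of_add_eq_zero_left ((h.2.2 φ hφ.1).trans (Finset.sum_eq_zero fun i _ => ?_))
  rw [intervalIntegral.integral_congr (g := fun _ => 0)
    fun s hs => by simp [edgePt_eq_zero_of_isTest hφ i hs]]
  simp

theorem HasLinearTrace.hasWeakRot {v : E2 → ℝ} {r : E2 → E2} {a : Fin (K.m + 3) → ℝ}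
    (h : K.HasLinearTrace v r a) : HasWeakRot K.carrier v r := by
  intro ψ hψ
  rw [h.2 ψ hψ.1, Finset.sum_eq_zero, sub_zero]
  intro i _
  rw [intervalIntegral.integral_congr (g := fun _ => 0)
    fun s hs => by simp [edgePt_eq_zero_of_isTest hψ i hs]]
  simp

/-- Gauss's theorem: Green's formula with the constant test function 1. -/
theorem HasNormalTrace.integral_div {v : E2 → E2} {d : E2 → ℝ} {g : Fin (K.m + 3) → E2 → ℝ}
    (h : K.HasNormalTrace v d g) :
    ∫ x in K.carrier, d x = ∑ i, ‖K.edgeVec i‖ * ∫ s in (0 : ℝ)..1, g i (K.edgePt i s) := by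
  have h1 : grad (fun _ => (1 : ℝ)) = 0 := by
    ext x i
    fin_cases i <;> simp [grad, pderiv]
  simpa [h1] using h.2.2 (fun _ => 1) contDiff_const

theorem HasNormalTrace.congr {v w : E2 → E2} {d : E2 → ℝ} {g : Fin (K.m + 3) → E2 → ℝ}
    (h : K.HasNormalTrace v d g) (hv : v =ᵐ[volume.restrict K.carrier] w) :
    K.HasNormalTrace w d g := by
  refine ⟨h.1, h.2.1, fun φ hφ => ?_⟩
  have h1 : ∫ x in K.carrier, inner ℝ (w x) (grad φ x) =
      ∫ x in K.carrier, inner ℝ (v x) (grad φ x) :=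
    integral_congr_ae (by filter_upwards [hv] with x hx; rw [hx])
  rw [h1]
  exact h.2.2 φ hφ

theorem HasNormalTrace.add {v w : E2 → E2} {d e : E2 → ℝ} {g k : Fin (K.m + 3) → E2 → ℝ}
    (hv : K.HasNormalTrace v d g) (hw : K.HasNormalTrace w e k) (hv2 : IsL2 K.carrier v)
    (hw2 : IsL2 K.carrier w) : K.HasNormalTrace (v + w) (d + e) (g + k) := by
  refine ⟨MemLp.add hv.1 hw.1, fun i => (hv.2.1 i).add (hw.2.1 i), fun φ hφ => ?_⟩
  have hφ2 := isL2_of_continuous hφ.continuous K.isBounded_carrier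
  have hg2 := isL2_of_continuous (contDiff_grad hφ).continuous K.isBounded_carrier
  have hc (i) : ContinuousOn (fun s => φ (K.edgePt i s)) (uIcc 0 1) :=
    (hφ.continuous.comp (K.continuous_edgePt i)).continuousOn
  simp only [Pi.add_apply, inner_add_left, add_mul]
  rw [integral_add (hv2.integrableOn_inner hg2) (hw2.integrableOn_inner hg2),
    integral_add (hv.1.integrableOn_mul hφ2) (hw.1.integrableOn_mul hφ2), add_add_add_comm,
    hv.2.2 φ hφ, hw.2.2 φ hφ, ← Finset.sum_add_distrib]
  refine Finset.sum_congr rfl fun i _ => ?_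
  rw [intervalIntegral.integral_add ((hv.2.1 i).mul_continuousOn (hc i))
    ((hw.2.1 i).mul_continuousOn (hc i)), mul_add]

theorem HasNormalTrace.smul {v : E2 → E2} {d : E2 → ℝ} {g : Fin (K.m + 3) → E2 → ℝ} (c : ℝ)
    (hv : K.HasNormalTrace v d g) : K.HasNormalTrace (c • v) (c • d) (c • g) := by
  refine ⟨MemLp.const_smul hv.1 c, fun i => (hv.2.1 i).const_mul c, fun φ hφ => ?_⟩
  simp only [Pi.smul_apply, real_inner_smul_left, smul_eq_mul, mul_assoc,
    intervalIntegral.integral_const_mul]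
  rw [integral_const_mul, integral_const_mul, ← mul_add, hv.2.2 φ hφ, Finset.mul_sum]
  exact Finset.sum_congr rfl fun i _ => by ring

theorem HasLinearTrace.add {v w : E2 → ℝ} {r s : E2 → E2} {a b : Fin (K.m + 3) → ℝ}
    (hv : K.HasLinearTrace v r a) (hw : K.HasLinearTrace w s b) (hv2 : IsL2 K.carrier v)
    (hw2 : IsL2 K.carrier w) : K.HasLinearTrace (v + w) (r + s) (a + b) := by
  refine ⟨MemLp.add hv.1 hw.1, fun ψ hψ => ?_⟩
  have hψ2 := isL2_of_continuous hψ.continuous K.isBounded_carrier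
  have hr2 := isL2_of_continuous (contDiff_rotVector hψ).continuous K.isBounded_carrier
  have hψc := hψ.continuous
  simp only [Pi.add_apply, inner_add_left, add_mul]
  rw [integral_add (hv.1.integrableOn_inner hψ2) (hw.1.integrableOn_inner hψ2),
    integral_add (hv2.integrableOn_mul hr2) (hw2.integrableOn_mul hr2), hv.2 ψ hψ, hw.2 ψ hψ,
    sub_add_sub_comm, ← Finset.sum_add_distrib]
  congr 1
  refine Finset.sum_congr rfl fun i _ => ?_
  rw [← intervalIntegral.integral_add]
  · exact intervalIntegral.integral_congr fun s _ => by ring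
  all_goals exact Continuous.intervalIntegrable (by fun_prop) _ _

/-- The rotor of a function with piecewise linear trace has no divergence, and its normal component
is the tangential derivative of the trace, constant on each edge. -/
theorem HasLinearTrace.hasNormalTrace {v : E2 → ℝ} {r : E2 → E2} {a : Fin (K.m + 3) → ℝ}
    (h : K.HasLinearTrace v r a) :
    K.HasNormalTrace r 0 (fun i _ => (a (i + 1) - a i) / ‖K.edgeVec i‖) := by
  refine ⟨MemLp.zero, fun i => intervalIntegrable_const, fun φ hφ => ?_⟩
  -- Along an edge, `∇φ` paired with the edge vector is the derivative of `φ` in the parameter `s`;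
  -- integration by parts moves it onto the linear trace, whose slope is `a (i + 1) - a i`.
  have hparts (i) : ∫ s in (0 : ℝ)..1,
      ((1 - s) * a i + s * a (i + 1)) * inner ℝ (grad φ (K.edgePt i s)) (K.edgeVec i) =
      a (i + 1) * φ (K.vertex (i + 1)) - a i * φ (K.vertex i) -
        ∫ s in (0 : ℝ)..1, (a (i + 1) - a i) * φ (K.edgePt i s) := by
    have hu (s : ℝ) : HasDerivAt (fun s => (1 - s) * a i + s * a (i + 1)) (a (i + 1) - a i) s := by
      refine ((((hasDerivAt_id s).const_sub 1).mul_const (a i)).add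
        ((hasDerivAt_id s).mul_const (a (i + 1)))).congr_deriv ?_
      ring
    have hp (s : ℝ) : HasDerivAt (K.edgePt i) (K.edgeVec i) s :=
      (((hasDerivAt_id s).smul_const (K.edgeVec i)).const_add (K.vertex i)).congr_deriv
        (one_smul ℝ _)
    have hw (s : ℝ) : HasDerivAt (fun s => φ (K.edgePt i s))
        (inner ℝ (grad φ (K.edgePt i s)) (K.edgeVec i)) s := by
      rw [inner_grad]
      exact ((hφ.differentiable (by simp)).differentiableAt.hasFDerivAt).comp_hasDerivAt s (hp s)
    have hg := (contDiff_grad hφ).continuous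
    rw [intervalIntegral.integral_mul_deriv_eq_deriv_mul (fun s _ => hu s) (fun s _ => hw s)
      intervalIntegrable_const (Continuous.intervalIntegrable (by fun_prop) _ _)]
    simp [edgePt, edgeVec]
  -- The endpoint terms cancel around the closed polygon, because the trace has a single value at
  -- each vertex.
  have htel : ∑ i, a (i + 1) * φ (K.vertex (i + 1)) = ∑ i, a i * φ (K.vertex i) :=
    Equiv.sum_comp (Equiv.addRight (1 : Fin (K.m + 3))) fun i => a i * φ (K.vertex i)
  have hgrad : ∫ x in K.carrier, v x * rotVector (grad φ) x = 0 := by simp [rotVector_grad hφ]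
  rw [h.2 _ (contDiff_grad hφ), hgrad, Finset.sum_congr rfl fun i _ => hparts i,
    Finset.sum_sub_distrib, Finset.sum_sub_distrib, htel]
  simp only [Pi.zero_apply, zero_mul, integral_zero, sub_self, zero_sub, neg_neg, add_zero,
    intervalIntegral.integral_const_mul]
  refine Finset.sum_congr rfl fun i _ => ?_
  -- The edge length in the line element cancels the one in the slope per unit length.
  rw [← mul_assoc, mul_div_cancel₀ _ (norm_ne_zero_iff.2 (K.edgeVec_ne_zero i))]

/-! ### Local nodal and edge spaces -/

theorem IsNodal.add {v w : E2 → ℝ} (hv : K.IsNodal v) (hw : K.IsNodal w) : K.IsNodal (v + w) := by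
  obtain ⟨hv2, r, a, hr, hr0⟩ := hv
  obtain ⟨hw2, s, b, hs, hs0⟩ := hw
  exact ⟨MemLp.add hv2 hw2, r + s, a + b, hr.add hs hv2 hw2, hr0.add hs0 hr.1 hs.1⟩

theorem IsEdge.add {v w : E2 → E2} (hv : K.IsEdge v) (hw : K.IsEdge w) : K.IsEdge (v + w) := by
  obtain ⟨hv2, hv0, d, k, hd⟩ := hv
  obtain ⟨hw2, hw0, e, l, he⟩ := hw
  exact ⟨MemLp.add hv2 hw2, hv0.add hw0 hv2 hw2, d + e, k + l, hd.add he hv2 hw2⟩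

theorem IsEdge.smul {v : E2 → E2} (c : ℝ) (hv : K.IsEdge v) : K.IsEdge (c • v) := by
  obtain ⟨hv2, hv0, d, k, hd⟩ := hv
  exact ⟨MemLp.const_smul hv2 c, hv0.smul c, c * d, c • k, hd.smul c⟩

/-- The rotor of a function of the local nodal space belongs to the local edge space. -/
theorem IsNodal.isEdge_of_hasWeakRot {v : E2 → ℝ} {r : E2 → E2} (hv : K.IsNodal v)
    (hr2 : IsL2 K.carrier r) (hr : HasWeakRot K.carrier v r) : K.IsEdge r := by
  obtain ⟨-, s, a, hs, hs0⟩ := hv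
  have hsr := hs.hasWeakRot.unique hr K.isOpen_carrier hs.1 hr2
  -- Harmonicity of `v` is precisely the vanishing rotor of `r`; the trace of `v` supplies zero
  -- divergence and constant normal components.
  exact ⟨hr2, hs0.congr hsr, 0, _, hs.hasNormalTrace.congr hsr⟩

/-- A field of the local edge space is divergence free if it has the same mean normal components on
the edges as a divergence-free field. -/
theorem IsEdge.hasWeakDiv_zero {w F : E2 → E2} {q : Fin (K.m + 3) → ℝ} (hw : K.IsEdge w)
    (hF : HasWeakDiv K.carrier F 0) (hFq : K.HasEdgeMeans F q) (hwq : K.HasEdgeMeans w q) :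
    HasWeakDiv K.carrier w 0 := by
  obtain ⟨-, -, d, k, hd⟩ := hw
  obtain ⟨e, g, he, hge⟩ := hFq
  obtain ⟨f, l, hf, hlf⟩ := hwq
  -- The edge means come with their own divergences, `e` of `F` and `f` of `w`; uniqueness
  -- identifies `e` with 0 and `f` with the constant `d`.
  have he0 := he.hasWeakDiv.unique hF K.isOpen_carrier he.1 MemLp.zero
  have hfd := hf.hasWeakDiv.unique hd.hasWeakDiv K.isOpen_carrier hf.1 hd.1
  have h1 : ∫ x in K.carrier, f x = ∫ x in K.carrier, e x := by
    rw [he.integral_div, hf.integral_div]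
    exact Finset.sum_congr rfl fun i _ => by rw [← hge i, ← hlf i]
  rw [integral_congr_ae hfd, integral_congr_ae he0] at h1
  have hpos : volume.real K.carrier ≠ 0 :=
    (ENNReal.toReal_pos (K.isOpen_carrier.measure_pos volume K.nonempty_carrier).ne'
      K.isBounded_carrier.measure_lt_top.ne).ne'
  -- Equal fluxes have left `d` times the positive area of the cell equal to 0.
  have hd0 : d = 0 := by simpa [hpos] using h1
  subst hd0
  exact hd.hasWeakDiv

/-! ### The Raviart–Thomas projection -/

theorem rtProj_add {v w : E2 → E2} (hv : IsL2 K.carrier v) (hw : IsL2 K.carrier w) :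
    K.rtProj (v + w) = K.rtProj v + K.rtProj w := by
  have hp : IsL2 K.carrier fun x => x - K.barycentre :=
    isL2_of_continuous (by fun_prop) K.isBounded_carrier
  ext1 x
  simp only [rtProj, Pi.add_apply, inner_add_left, setAverage_eq]
  rw [integral_add (hv.integrableOn K.isBounded_carrier) (hw.integrableOn K.isBounded_carrier),
    integral_add (hv.integrableOn_inner hp) (hw.integrableOn_inner hp), add_div, add_smul, smul_add]
  abel

theorem continuous_rtProj (w : E2 → E2) : Continuous (K.rtProj w) := by
  unfold rtProj
  fun_prop

theorem isL2_rtProj (w : E2 → E2) : IsL2 K.carrier (K.rtProj w) :=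
  isL2_of_continuous (continuous_rtProj w) K.isBounded_carrier

end PolygonalCell

/-! ### Meshes and the discrete inner product -/

namespace PolygonalMesh

variable {Ω : Set E2}

theorem isOpen (M : PolygonalMesh Ω) : IsOpen Ω := by
  rw [← M.interior_closure]
  exact isOpen_interior

/-- The cover only places a cell in the closure of `Ω`; being open, the cell lies in the interior of
that closure, which is `Ω`. -/
theorem cell_subset (M : PolygonalMesh Ω) (c : Fin M.numCells) : (M.cell c).carrier ⊆ Ω := by
  refine Subset.trans (interior_maximal ?_ (M.cell c).isOpen_carrier) M.interior_closure.subset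
  rw [M.cover]
  exact subset_closure.trans (subset_iUnion (fun c => closure (M.cell c).carrier) c)

/-- The closed cells cover `Ω`, and their frontiers are finite unions of segments, hence null. -/
theorem ae_of_forall_cell (M : PolygonalMesh Ω) {p : E2 → Prop}
    (h : ∀ c, ∀ᵐ x ∂(volume.restrict (M.cell c).carrier), p x) :
    ∀ᵐ x ∂(volume.restrict Ω), p x := by
  have hcell (c) : ∀ᵐ x ∂(volume : Measure E2), x ∈ (M.cell c).carrier → p x :=
    (ae_restrict_iff' (M.cell c).measurableSet_carrier).1 (h c)
  have hfr (c) : ∀ᵐ x ∂(volume : Measure E2), x ∉ frontier (M.cell c).carrier :=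
    measure_eq_zero_iff_ae_notMem.1 (M.cell c).volume_frontier
  refine (ae_restrict_iff' M.isOpen.measurableSet).2 ?_
  filter_upwards [ae_all_iff.2 hcell, ae_all_iff.2 hfr] with x h1 h2 hx
  have hx' := subset_closure hx
  rw [M.cover] at hx'
  obtain ⟨c, hc⟩ := mem_iUnion.1 hx'
  refine h1 c (by_contra fun hn => h2 c ?_)
  rw [(M.cell c).isOpen_carrier.frontier_eq]
  exact ⟨hc, hn⟩

variable {M : PolygonalMesh Ω}

theorem IsNodal.add {v w : E2 → ℝ} (hv : M.IsNodal v) (hw : M.IsNodal w) : M.IsNodal (v + w) :=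
  ⟨hv.1.add hw.1, fun c => (hv.2 c).add (hw.2 c)⟩

theorem IsEdge.add {v w : E2 → E2} (hv : M.IsEdge v) (hw : M.IsEdge w) : M.IsEdge (v + w) :=
  ⟨hv.1.add hw.1, fun c => (hv.2 c).add (hw.2 c)⟩

theorem IsEdge.smul {v : E2 → E2} (a : ℝ) (hv : M.IsEdge v) : M.IsEdge (a • v) :=
  ⟨hv.1.smul a, fun c => (hv.2 c).smul a⟩

theorem IsEdge.sub {v w : E2 → E2} (hv : M.IsEdge v) (hw : M.IsEdge w) : M.IsEdge (v - w) := by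
  have := hv.add (hw.smul (-1))
  rwa [neg_one_smul, ← sub_eq_add_neg] at this

/-- The rotor maps the nodal space into the edge space. -/
theorem IsNodal.isEdge_weakRot {v : E2 → ℝ} (hv : M.IsNodal v) : M.IsEdge (weakRot Ω v) := by
  obtain ⟨h2, h⟩ := hv.1.weakRot_spec
  exact ⟨⟨h2, 0, MemLp.zero, h.hasWeakDiv⟩, fun c => (hv.2 c).isEdge_of_hasWeakRot
    (h2.mono (M.cell_subset c)) (h.mono M.isOpen.measurableSet (M.cell_subset c))⟩

/-- A field of the edge space which is divergence free in each cell is divergence free. -/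
theorem IsEdge.hasWeakDiv_zero_of_forall_cell {w : E2 → E2} (hw : M.IsEdge w)
    (h : ∀ c, HasWeakDiv (M.cell c).carrier w 0) : HasWeakDiv Ω w 0 := by
  -- Membership in `H(div; Ω)` already excludes jumps of the normal component across edges: a square
  -- integrable global divergence `d` exists, and it can be identified cell by cell.
  obtain ⟨-, d, hd2, hd⟩ := hw.1
  refine hd.congr (ae_eq_refl w) (M.ae_of_forall_cell fun c => ?_)
  exact (hd.mono M.isOpen.measurableSet (M.cell_subset c)).unique (h c)
    (M.cell c).isOpen_carrier (hd2.mono (M.cell_subset c)) MemLp.zero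

theorem IsEdgeInterpolant.hasWeakDiv_zero {F w : E2 → E2} (h : M.IsEdgeInterpolant F w)
    (hF : HasWeakDiv Ω F 0) : HasWeakDiv Ω w 0 := by
  refine h.1.hasWeakDiv_zero_of_forall_cell fun c => ?_
  obtain ⟨q, hFq, hwq⟩ := h.2 c
  exact (h.1.2 c).hasWeakDiv_zero (hF.mono M.isOpen.measurableSet (M.cell_subset c)) hFq hwq

/-- Serves to merge the two terms of Faraday's law into one product with the residual. Square
integrability lets the integrals in the projection split. -/
theorem edgeInner_add_left (S : M.EdgeStabilization) {v w : E2 → E2} (hv : M.IsEdge v)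
    (hw : M.IsEdge w) (z : E2 → E2) :
    M.edgeInner S (v + w) z = M.edgeInner S v z + M.edgeInner S w z := by
  simp only [edgeInner]
  rw [← Finset.sum_add_distrib]
  refine Finset.sum_congr rfl fun c _ => ?_
  have hz := PolygonalCell.isL2_rtProj (K := M.cell c) z
  rw [PolygonalCell.rtProj_add (hv.2 c).1 (hw.2 c).1, add_sub_add_comm, map_add,
    LinearMap.add_apply]
  simp only [Pi.add_apply, inner_add_left]
  rw [integral_add ((PolygonalCell.isL2_rtProj v).integrableOn_inner hz)
    ((PolygonalCell.isL2_rtProj w).integrableOn_inner hz)]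
  ring

/-- The discrete inner product of the edge space is definite. -/
theorem IsEdge.ae_eq_zero_of_edgeInner_self (S : M.EdgeStabilization) {w : E2 → E2}
    (hw : M.IsEdge w) (h : M.edgeInner S w w = 0) : w =ᵐ[volume.restrict Ω] 0 := by
  have h1 (c) : 0 ≤ ∫ x in (M.cell c).carrier,
      (inner ℝ ((M.cell c).rtProj w x) ((M.cell c).rtProj w x) : ℝ) :=
    integral_nonneg fun x => real_inner_self_nonneg
  have h2 (c) : 0 ≤ ∫ x in (M.cell c).carrier, ‖w x - (M.cell c).rtProj w x‖ ^ 2 :=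
    integral_nonneg fun x => by positivity
  have h3 (c) := S.lower_bound c w (hw.2 c)
  have h4 (c) := mul_nonneg S.lower_pos.le (h2 c)
  -- The lower stabilization bound makes every cell contribution nonnegative, so each vanishes, and
  -- with it both the projected part and the remainder of `w`.
  rw [edgeInner, Finset.sum_eq_zero_iff_of_nonneg
    fun c _ => add_nonneg (h1 c) ((h4 c).trans (h3 c))] at h
  refine M.ae_of_forall_cell fun c => ?_
  have hc := h c (Finset.mem_univ c)
  have hP := PolygonalCell.isL2_rtProj (K := M.cell c) w
  have e1 := (integral_eq_zero_iff_of_nonneg (fun x => real_inner_self_nonneg)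
    (hP.integrableOn_inner hP)).1 (le_antisymm (by linarith [h3 c, h4 c]) (h1 c))
  have hle : ∫ x in (M.cell c).carrier, ‖w x - (M.cell c).rtProj w x‖ ^ 2 ≤ 0 :=
    nonpos_of_mul_nonpos_right (by linarith [h3 c, h1 c]) S.lower_pos
  have e2 := (integral_eq_zero_iff_of_nonneg (fun x => by positivity)
    ((MemLp.sub (hw.2 c).1 hP).integrable_norm_pow (by norm_num))).1 (le_antisymm hle (h2 c))
  filter_upwards [e1, e2] with x h5 h6
  have h7 : (M.cell c).rtProj w x = 0 := inner_self_eq_zero.1 h5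
  have h8 : w x - (M.cell c).rtProj w x = 0 := by simpa using h6
  simpa [h7] using h8

/-- Faraday's law holds almost everywhere: a time step changes the magnetic field by a rotor. -/
theorem IsStep.ae_eq {S : M.EdgeStabilization} {R : M.NodalStabilization} {ϖ : M.VertexWeights}
    {u : E2 → E2} {θ Δt : ℝ} {E₀ : E2 → ℝ} {B₁ B₂ : E2 → E2} {Ehat : E2 → ℝ}
    (h : M.IsStep S R ϖ u θ Δt E₀ B₁ B₂ Ehat) (hΔt : Δt ≠ 0) (h1 : M.IsEdge B₁)
    (h2 : M.IsEdge B₂) (hE : M.IsNodal Ehat) :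
    ∃ v, M.IsNodal v ∧ B₁ + (-Δt) • weakRot Ω v =ᵐ[volume.restrict Ω] B₂ := by
  obtain ⟨I₀, J, hI, -, hF, -⟩ := h
  have hv := hE.add hI.1
  have hd := (h2.sub h1).smul Δt⁻¹
  have hr := hv.isEdge_weakRot
  have hw := hd.add hr
  -- Faraday's law tested with its own residual, which lies in `E_h`.
  have h0 := hF _ hw
  rw [← edgeInner_add_left S hd hr] at h0
  refine ⟨Ehat + I₀, hv, ?_⟩
  filter_upwards [hw.ae_eq_zero_of_edgeInner_self S h0] with x hx
  have hx' : Δt⁻¹ • (B₂ x - B₁ x) + weakRot Ω (Ehat + I₀) x = 0 := hx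
  simp only [Pi.add_apply, Pi.smul_apply]
  rw [eq_neg_of_add_eq_zero_right hx', smul_neg, neg_smul, neg_neg, smul_inv_smul₀ hΔt]
  abel

/-- The increment is a multiple of a weak rotor; a weak divergence does not see the null set on
which Faraday's law may fail. -/
theorem IsStep.hasWeakDiv_zero {S : M.EdgeStabilization} {R : M.NodalStabilization}
    {ϖ : M.VertexWeights} {u : E2 → E2} {θ Δt : ℝ} {E₀ : E2 → ℝ} {B₁ B₂ : E2 → E2} {Ehat : E2 → ℝ}
    (h : M.IsStep S R ϖ u θ Δt E₀ B₁ B₂ Ehat) (hΔt : Δt ≠ 0) (h1 : M.IsEdge B₁)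
    (h2 : M.IsEdge B₂) (hE : M.IsNodal Ehat) (hdiv : HasWeakDiv Ω B₁ 0) :
    HasWeakDiv Ω B₂ 0 := by
  obtain ⟨v, hv, hB⟩ := h.ae_eq hΔt h1 h2 hE
  have hr := (hv.1.weakRot_spec.2.hasWeakDiv).smul (-Δt)
  rw [smul_zero] at hr
  have := hdiv.add hr h1.1.1 (MemLp.const_smul hv.1.weakRot_spec.1 _) MemLp.zero MemLp.zero
  exact this.congr hB (ae_of_all _ fun x => add_zero (0 : ℝ))

end PolygonalMesh

end VEM

/-! ### Induction over the time steps -/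

theorem mainTheorem4 (Ω : Set VEM.E2) (M : VEM.PolygonalMesh Ω)
    (S : M.EdgeStabilization) (R : M.NodalStabilization) (ϖ : M.VertexWeights)
    (u : VEM.E2 → VEM.E2) (θ Δt : ℝ) (hθ : θ ∈ Set.Icc (0 : ℝ) 1) (hΔt : 0 < Δt) (N : ℕ)
    (E₀ : ℝ → VEM.E2 → ℝ) (B₀ : VEM.E2 → VEM.E2)
    (hB₀ : VEM.IsL2 Ω B₀) (hdiv : VEM.HasWeakDiv Ω B₀ 0)
    (B : ℕ → VEM.E2 → VEM.E2) (Ehat : ℕ → VEM.E2 → ℝ)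
    (hsol : M.IsSolution S R ϖ u θ Δt N E₀ B₀ B Ehat) :
    ∀ n ≤ N, VEM.HasWeakDiv Ω (B n) 0 := by
  intro n
  induction n with
  | zero => exact fun _ => hsol.initial.hasWeakDiv_zero hdiv
  | succ n ih =>
    intro hn
    -- The bound `n + 1 ≤ N` is also `n < N`, the range in which step `n` is defined.
    exact (hsol.step n hn).hasWeakDiv_zero hΔt.ne' (hsol.edge n (Nat.le_of_succ_le hn))
      (hsol.edge (n + 1) hn) (hsol.nodal n hn).1 (ih (Nat.le_of_succ_le hn))
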